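/- For a finite group $G$ and conjugacy classes $C, D$ of $G$, say that $C$ and $D$ invariably generate $G$ if $\langle x, y\rangle = G$ for every $x \in C$ and every $y \in D$; say that $G$ is invariably $2$-generated if some two (not necessarily distinct) conjugacy classes of $G$ invariably generate $G$. The invariably generating graph $\Lambda(G)$ is the undirected graph whose vertices are the conjugacy classes of $G$ different from $\{1\}$, two distinct vertices being adjacent if they invariably generate $G$. The graph $\Lambda^+(G)$ is obtained from $\Lambda(G)$ by removing the isolated vertices. Theorem. For every positive integer $n$ there exists a finite group $G$ such that $\Lambda^+(G)$ has more than $n$ connected components. Moreover, $G$ can be taken of the form $\mathrm{PSL}_2(q)^{\beta}$ for some prime power $q \geq 4$, where $\beta$ is the largest integer $t$ for which $\mathrm{PSL}_2(q)^{t}$ is invariably $2$-generated (in particular such a largest $t$ exists). -/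

import Mathlib

open scoped MatrixGroups

/-- Two conjugacy classes `C`, `D` of `G` invariably generate `G` if `⟨x, y⟩ = G` for every
`x ∈ C` and every `y ∈ D`. -/
def InvariablyGenerates {G : Type*} [Group G] (C D : ConjClasses G) : Prop :=
  ∀ x ∈ C.carrier, ∀ y ∈ D.carrier, Subgroup.closure {x, y} = ⊤

/-- `G` is invariably `2`-generated if some two conjugacy classes of `G` invariably generate `G`. -/
def IsInvariablyTwoGenerated (G : Type*) [Group G] : Prop :=
  ∃ C D : ConjClasses G, InvariablyGenerates C D

theorem InvariablyGenerates.symm {G : Type*} [Group G] {C D : ConjClasses G}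
    (h : InvariablyGenerates C D) : InvariablyGenerates D C := by
  intro x hx y hy
  rw [Set.pair_comm]
  exact h y hy x hx

/-- The invariably generating graph `Λ(G)`: the vertices are the conjugacy classes of `G` different
from `{1}`, and two distinct vertices are adjacent if they invariably generate `G`. -/
def invGenGraph (G : Type*) [Group G] : SimpleGraph {C : ConjClasses G // C ≠ ConjClasses.mk 1} where
  Adj C D := C ≠ D ∧ InvariablyGenerates C.1 D.1
  symm := ⟨fun _ _ h => ⟨h.1.symm, h.2.symm⟩⟩
  loopless := ⟨fun _ h => h.1 rfl⟩

/-- The graph `Λ⁺(G)`, obtained from `Λ(G)` by removing the isolated vertices. -/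
def invGenGraphPlus (G : Type*) [Group G] :
    SimpleGraph {C : {C : ConjClasses G // C ≠ ConjClasses.mk 1} // ¬ (invGenGraph G).IsIsolated C} :=
  (invGenGraph G).induce {C | ¬ (invGenGraph G).IsIsolated C}

/-!
Let `S = PSL(2, F)` with `|F| = q` even; the centre of `SL(2, F)` is trivial, so `S ≅ SL(2, F)`.

Every element of `S` is conjugate into the Borel subgroup or into a fixed cyclic non-split torus of
order `q + 1`. Hence in an invariably generating pair exactly one member is a nontrivial element of
a non-split torus, which means that it is nontrivial of order dividing `q + 1`, a condition
invariant under automorphisms (`SL2.invGenDichotomy`).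

In a power `S ^ ι` two elements generate invariably exactly when they do so in each coordinate and
no automorphism of `S` links two coordinates (`invariablyGenerates_pi_iff`, by Goursat's lemma and
perfectness). So for adjacent classes `x`, `y` of `S ^ ι` the coordinates where `x` is non-split are
exactly those where `y` is not. The resulting partition of `ι` into two parts is constant on
connected components. If it is nontrivial, permuting the coordinates of `x` produces
many different partitions, and therefore at least `|ι| / 2` components; if it is trivial, exchanging
`x` and `y` at one coordinate makes it nontrivial
(`InvGenDichotomy.lt_card_connectedComponent_of_isInvariablyTwoGenerated`).

Since unlinked coordinates are in particular distinct, the exponents `t` with `S ^ t` invariably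
`2`-generated are bounded, and it remains to find `q` for which the maximum `β` is large. A subgroup
containing the torus and an element outside its normalizer is everything
(`IsTorusGenerator.eq_top_of_mem`). To see this, write elements of `SL(2, F)` as `z ↦ a z + c z̄` on
the quadratic extension; the double coset of the torus is determined by the norm of `c`, the norms
occurring in the subgroup form an additive subgroup of `F`, and one element outside the normalizer
already provides more than `q / 2` of them. So a generator of the torus and any element of order
`d > 1` dividing `q - 1` invariably generate `S`. For `q = 2 ^ 2 ^ N` there are at least `N` such
`d`, and pairs with different `d` are not linked, so `β ≥ N`.
-/

/-! ### Invariable generation and conjugate representatives -/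

theorem invariablyGenerates_mk_iff {G : Type*} [Group G] {x y : G} :
    InvariablyGenerates (ConjClasses.mk x) (ConjClasses.mk y) ↔
      ∀ x' y', IsConj x x' → IsConj y y' → Subgroup.closure {x', y'} = ⊤ := by
  simp only [InvariablyGenerates, ConjClasses.mem_carrier_iff_mk_eq, ConjClasses.mk_eq_mk_iff_isConj]
  exact ⟨fun h x' y' hx hy => h x' hx.symm y' hy.symm, fun h x' hx y' hy => h x' y' hx.symm hy.symm⟩

theorem isConj_map_mulEquiv_iff {G H : Type*} [Group G] [Group H] (e : G ≃* H) {a b : G} :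
    IsConj (e a) (e b) ↔ IsConj a b :=
  ⟨fun h => by simpa using e.symm.toMonoidHom.map_isConj h, fun h => e.toMonoidHom.map_isConj h⟩

theorem InvariablyGenerates.map_mulEquiv {G H : Type*} [Group G] [Group H] (e : G ≃* H) {x y : G}
    (h : InvariablyGenerates (ConjClasses.mk x) (ConjClasses.mk y)) :
    InvariablyGenerates (ConjClasses.mk (e x)) (ConjClasses.mk (e y)) := by
  rw [invariablyGenerates_mk_iff] at h ⊢
  intro x' y' hx hy
  have := congrArg (Subgroup.map e.toMonoidHom) (h (e.symm x') (e.symm y')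
    ((isConj_map_mulEquiv_iff e).1 (by simpa using hx))
    ((isConj_map_mulEquiv_iff e).1 (by simpa using hy)))
  rw [MonoidHom.map_closure, Subgroup.map_top_of_surjective _ e.surjective] at this
  simpa [Set.image_pair] using this

theorem isConj_pi_iff {ι : Type*} {S : ι → Type*} [∀ i, Group (S i)] {x y : ∀ i, S i} :
    IsConj x y ↔ ∀ i, IsConj (x i) (y i) := by
  simp only [isConj_iff]
  refine ⟨fun ⟨c, hc⟩ i => ⟨c i, congrFun hc i⟩, fun h => ?_⟩
  choose c hc using h
  exact ⟨c, funext hc⟩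

/-- Changing one coordinate within its conjugacy class does not leave the conjugacy class. -/
theorem isConj_update {ι S : Type*} [DecidableEq ι] [Group S] {z : ι → S} {i : ι} {s : S}
    (hs : IsConj (z i) s) : IsConj z (Function.update z i s) := by
  refine isConj_pi_iff.2 fun j => ?_
  by_cases hj : j = i
  · subst hj; simpa using hs
  · rw [Function.update_of_ne hj]

theorem InvariablyGenerates.apply {ι S : Type*} [Group S] {x y : ι → S}
    (h : InvariablyGenerates (ConjClasses.mk x) (ConjClasses.mk y)) (i : ι) :
    InvariablyGenerates (ConjClasses.mk (x i)) (ConjClasses.mk (y i)) := by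
  classical
  refine invariablyGenerates_mk_iff.2 fun x' y' hx hy => ?_
  have := congrArg (Subgroup.map (Pi.evalMonoidHom (fun _ => S) i))
    (invariablyGenerates_mk_iff.1 h _ _ (isConj_update hx) (isConj_update hy))
  rw [MonoidHom.map_closure, Subgroup.map_top_of_surjective _ (Function.surjective_eval i)] at this
  simpa [Set.image_pair] using this

/-! ### Subdirect products of simple groups -/

section Subdirect

variable {ι S : Type*} [Group S]

/-- The commutator argument: if elements of `H` that are trivial on `T` reach every value at `i`,
and so do elements trivial at `j`, then their commutators are trivial on `insert j T` and reach
every value at `i`, because `S` is perfect. -/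
theorem exists_mem_apply_eq_and_eq_one [Group.IsPerfect S] {H : Subgroup (ι → S)} {i : ι}
    (h₁ : ∀ a, ∃ g ∈ H, g i = a) (h₂ : ∀ j, j ≠ i → ∀ a, ∃ g ∈ H, g i = a ∧ g j = 1)
    (T : Finset ι) (hT : i ∉ T) (a : S) : ∃ g ∈ H, g i = a ∧ ∀ j ∈ T, g j = 1 := by
  classical
  induction T using Finset.induction_on generalizing a with
  | empty => obtain ⟨g, hg, rfl⟩ := h₁ a; exact ⟨g, hg, rfl, by simp⟩
  | insert j T hj ih =>
    rw [Finset.mem_insert, not_or] at hT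
    let K : Subgroup S :=
      (H ⊓ Subgroup.pi (insert j T : Finset ι) fun _ => ⊥).map (Pi.evalMonoidHom (fun _ => S) i)
    have hK : commutator S ≤ K := by
      rw [commutator_def, Subgroup.commutator_le]
      intro s _ t _
      obtain ⟨g, hg, hgi, hgT⟩ := ih hT.2 s
      obtain ⟨k, hk, hki, hkj⟩ := h₂ j (Ne.symm hT.1) t
      refine ⟨g * k * g⁻¹ * k⁻¹, ⟨?_, ?_⟩, ?_⟩
      · exact H.mul_mem (H.mul_mem (H.mul_mem hg hk) (H.inv_mem hg)) (H.inv_mem hk)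
      · intro l hl
        rcases Finset.mem_insert.1 hl with rfl | hl
        · simp [hkj]
        · simp [hgT l hl]
      · simp [commutatorElement_def, hgi, hki]
    rw [Group.IsPerfect.commutator_eq_top] at hK
    obtain ⟨g, ⟨hg, hgT⟩, rfl⟩ := hK (Subgroup.mem_top a)
    exact ⟨g, hg, rfl, fun l hl => hgT l hl⟩

theorem Subgroup.eq_top_of_pairs_surjective [Finite ι] [Group.IsPerfect S] {H : Subgroup (ι → S)}
    (h₁ : ∀ i a, ∃ g ∈ H, g i = a)
    (h₂ : ∀ i j, i ≠ j → ∀ a b, ∃ g ∈ H, g i = a ∧ g j = b) : H = ⊤ := by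
  classical
  have := Fintype.ofFinite ι
  refine (Subgroup.eq_top_iff' H).2 fun x => Subgroup.pi_mem_of_mulSingle_mem x fun i => ?_
  obtain ⟨g, hg, hgi, hgT⟩ := exists_mem_apply_eq_and_eq_one (h₁ i)
    (fun j hj a => h₂ i j hj.symm a 1) (Finset.univ.erase i) (Finset.notMem_erase i _) (x i)
  convert hg using 1
  funext j
  by_cases hj : j = i
  · subst hj; simp [hgi]
  · rw [Pi.mulSingle_eq_of_ne hj, hgT j (by simp [hj])]

/-- Goursat's lemma for two factors equal to the same finite simple group: a subdirect subgroup
that is not the whole product is the graph of an automorphism. -/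
theorem Subgroup.exists_mulEquiv_or_pair_surjective [Finite S] [IsSimpleGroup S]
    (H : Subgroup (S × S)) (h₁ : ∀ a, ∃ b, (a, b) ∈ H) (h₂ : ∀ b, ∃ a, (a, b) ∈ H) :
    (∃ φ : S ≃* S, ∀ g ∈ H, φ g.1 = g.2) ∨ H = ⊤ := by
  let p : H →* S := (MonoidHom.fst S S).comp H.subtype
  let r : H →* S := (MonoidHom.snd S S).comp H.subtype
  have hp : Function.Surjective p := fun a => (h₁ a).elim fun b hb => ⟨⟨_, hb⟩, rfl⟩
  have hr : Function.Surjective r := fun b => (h₂ b).elim fun a ha => ⟨⟨_, ha⟩, rfl⟩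
  rcases (Subgroup.normal_goursatFst (I := H) hp).eq_bot_or_eq_top with h | h
  · left
    have hri : Function.Injective r := by
      rw [injective_iff_map_eq_one]
      rintro ⟨⟨a, b⟩, hab⟩ (rfl : b = 1)
      have : a ∈ H.goursatFst := Subgroup.mem_goursatFst.2 hab
      rw [h, Subgroup.mem_bot] at this
      subst this; rfl
    have hcard : Nat.card H = Nat.card S := Nat.card_congr (Equiv.ofBijective r ⟨hri, hr⟩)
    have hpb : Function.Bijective p := (Nat.bijective_iff_surjective_and_card p).2 ⟨hp, hcard⟩
    refine ⟨(MulEquiv.ofBijective p hpb).symm.trans (MulEquiv.ofBijective r ⟨hri, hr⟩), ?_⟩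
    intro g hg
    have : (MulEquiv.ofBijective p hpb).symm g.1 = ⟨g, hg⟩ := by
      rw [MulEquiv.symm_apply_eq]; rfl
    simp only [MulEquiv.trans_apply, this]
    rfl
  · right
    refine (Subgroup.eq_top_iff' H).2 fun ⟨a, b⟩ => ?_
    obtain ⟨c, hc⟩ := h₂ b
    have : a * c⁻¹ ∈ H.goursatFst := h ▸ Subgroup.mem_top _
    simpa using H.mul_mem (Subgroup.mem_goursatFst.1 this) hc

/-- Two pairs of elements of `S` are linked if some automorphism of `S` carries the conjugacy
classes of the first pair to those of the second. -/
def Linked (x y : S × S) : Prop :=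
  ∃ φ : S ≃* S, IsConj (φ x.1) y.1 ∧ IsConj (φ x.2) y.2

/-- Two elements of a power of a nonabelian finite simple group invariably generate it exactly when
they do so in each coordinate and no two coordinates are linked by an automorphism. -/
theorem invariablyGenerates_pi_iff [Finite ι] [Finite S] [IsSimpleGroup S] [Group.IsPerfect S]
    {x y : ι → S} :
    InvariablyGenerates (ConjClasses.mk x) (ConjClasses.mk y) ↔
      (∀ i, InvariablyGenerates (ConjClasses.mk (x i)) (ConjClasses.mk (y i))) ∧
        ∀ i j, i ≠ j → ¬ Linked (x i, y i) (x j, y j) := by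
  classical
  refine ⟨fun h => ⟨h.apply, ?_⟩, fun ⟨h, hl⟩ => ?_⟩
  · rintro i j hij ⟨φ, h₁, h₂⟩
    have hcl := invariablyGenerates_mk_iff.1 h _ _ (isConj_update h₁.symm) (isConj_update h₂.symm)
    have hle : Subgroup.closure {Function.update x j (φ (x i)), Function.update y j (φ (y i))} ≤
        (φ.toMonoidHom.comp (Pi.evalMonoidHom (fun _ => S) i)).eqLocus
          (Pi.evalMonoidHom (fun _ => S) j) := by
      rw [Subgroup.closure_le]
      rintro _ (rfl | rfl) <;>
      · simp [MonoidHom.eqLocus, hij]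
    rw [hcl] at hle
    obtain ⟨s, hs⟩ := exists_ne (1 : S)
    have := hle (Subgroup.mem_top (Pi.mulSingle i s))
    change φ ((Pi.mulSingle i s : ι → S) i) = (Pi.mulSingle i s : ι → S) j at this
    rw [Pi.mulSingle_eq_same, Pi.mulSingle_eq_of_ne hij.symm] at this
    exact hs (by simpa using this)
  · refine invariablyGenerates_mk_iff.2 fun x' y' hx hy => ?_
    rw [isConj_pi_iff] at hx hy
    set H := Subgroup.closure {x', y'} with hH
    have hx'H : x' ∈ H := Subgroup.subset_closure (by simp)
    have hy'H : y' ∈ H := Subgroup.subset_closure (by simp)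
    have hsurj : ∀ i a, ∃ g ∈ H, g i = a := by
      intro i a
      have : H.map (Pi.evalMonoidHom (fun _ => S) i) = ⊤ := by
        rw [hH, MonoidHom.map_closure, Set.image_pair]
        exact invariablyGenerates_mk_iff.1 (h i) _ _ (hx i) (hy i)
      obtain ⟨g, hg, rfl⟩ := this ▸ Subgroup.mem_top a
      exact ⟨g, hg, rfl⟩
    refine Subgroup.eq_top_of_pairs_surjective hsurj fun i j hij a b => ?_
    let K : Subgroup (S × S) :=
      H.map ((Pi.evalMonoidHom (fun _ => S) i).prod (Pi.evalMonoidHom (fun _ => S) j))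
    rcases K.exists_mulEquiv_or_pair_surjective
      (fun a => (hsurj i a).elim fun g hg => ⟨g j, g, hg.1, Prod.ext hg.2 rfl⟩)
      (fun a => (hsurj j a).elim fun g hg => ⟨g i, g, hg.1, Prod.ext rfl hg.2⟩) with ⟨φ, hφ⟩ | hK
    · refine absurd ⟨φ, ?_, ?_⟩ (hl i j hij)
      · have : φ (x' i) = x' j := hφ _ ⟨x', hx'H, rfl⟩
        exact ((φ.toMonoidHom.map_isConj (hx i)).trans (this ▸ IsConj.refl _)).trans (hx j).symm
      · have : φ (y' i) = y' j := hφ _ ⟨y', hy'H, rfl⟩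
        exact ((φ.toMonoidHom.map_isConj (hy i)).trans (this ▸ IsConj.refl _)).trans (hy j).symm
    · obtain ⟨g, hg, hgab⟩ : (a, b) ∈ K := hK ▸ Subgroup.mem_top _
      exact ⟨g, hg, congrArg Prod.fst hgab, congrArg Prod.snd hgab⟩

end Subdirect

/-! ### Components of the invariably generating graph of a power -/

section Components

variable {ι S : Type*} [Group S]

/-- A group automorphism of a power of `S` permuting the coordinates preserves invariable
generation. -/
theorem InvariablyGenerates.comp_perm {x y : ι → S} (σ : Equiv.Perm ι)
    (h : InvariablyGenerates (ConjClasses.mk x) (ConjClasses.mk y)) :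
    InvariablyGenerates (ConjClasses.mk (x ∘ σ)) (ConjClasses.mk (y ∘ σ)) :=
  h.map_mulEquiv (MulEquiv.arrowCongr σ.symm (MulEquiv.refl S))

/-- A dichotomy for invariable generation: an automorphism-invariant property of elements of `S`,
failing at `1`, that holds for exactly one member of each invariably generating pair. -/
structure InvGenDichotomy (P : S → Prop) : Prop where
  map_iff : ∀ (φ : S ≃* S) a, P (φ a) ↔ P a
  not_one : ¬ P 1
  iff_not : ∀ a b, InvariablyGenerates (ConjClasses.mk a) (ConjClasses.mk b) → (P a ↔ ¬ P b)

namespace InvGenDichotomy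

variable {P : S → Prop} (hP : InvGenDichotomy P)
include hP

theorem iff_of_isConj {a b : S} (h : IsConj a b) : P a ↔ P b := by
  obtain ⟨c, rfl⟩ := isConj_iff.1 h
  exact (hP.map_iff (MulAut.conj c) a).symm

theorem iff_not_apply {x y : ι → S}
    (h : InvariablyGenerates (ConjClasses.mk x) (ConjClasses.mk y)) (i : ι) :
    P (x i) ↔ ¬ P (y i) :=
  hP.iff_not _ _ (h.apply i)

/-- Whether coordinates `i` and `b` of a conjugacy class of `ι → S` agree with respect to `P` is
constant on the connected components of the invariably generating graph. -/
theorem iff_of_reachable {C D : {C : {C : ConjClasses (ι → S) // C ≠ ConjClasses.mk 1} //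
      ¬ (invGenGraph (ι → S)).IsIsolated C}}
    (h : (invGenGraphPlus (ι → S)).Reachable C D) (i b : ι) :
    ((P (C.1.1.out i) ↔ P (C.1.1.out b)) ↔ (P (D.1.1.out i) ↔ P (D.1.1.out b))) := by
  rw [SimpleGraph.reachable_iff_reflTransGen] at h
  induction h with
  | refl => rfl
  | @tail D E _ h ih =>
    have h' : InvariablyGenerates (ConjClasses.mk D.1.1.out) (ConjClasses.mk E.1.1.out) := by
      have : InvariablyGenerates D.1.1 E.1.1 := h.2
      rwa [← Quotient.out_eq D.1.1, ← Quotient.out_eq E.1.1] at this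
    rw [ih, hP.iff_not_apply h' i, hP.iff_not_apply h' b]
    tauto

theorem iff_out (x : ι → S) (i : ι) : P ((ConjClasses.mk x).out i) ↔ P (x i) :=
  hP.iff_of_isConj (isConj_pi_iff.1 (ConjClasses.mk_eq_mk_iff_isConj.1 (Quotient.out_eq _)) i)

/-- If `P` holds at some coordinate of `x` and fails at another, then the components of the classes
obtained from `x` by swapping `b` with a coordinate of the other kind are pairwise distinct. -/
theorem card_le_card_connectedComponent [Finite ι] [Finite S] {x y : ι → S}
    (h : InvariablyGenerates (ConjClasses.mk x) (ConjClasses.mk y)) {i j : ι}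
    (hi : P (x i)) (hj : ¬ P (x j)) (b : ι) :
    Nat.card {a : ι // ¬ (P (x a) ↔ P (x b))} ≤
      Nat.card (invGenGraphPlus (ι → S)).ConnectedComponent := by
  classical
  have ne_one : ∀ z : ι → S, (∃ i, P (z i)) → ConjClasses.mk z ≠ ConjClasses.mk 1 := by
    rintro z ⟨i, hi⟩ hz
    exact hP.not_one ((hP.iff_of_isConj
      (isConj_pi_iff.1 (ConjClasses.mk_eq_mk_iff_isConj.1 hz) i)).1 hi)
  let vx : ∀ σ : Equiv.Perm ι, {C : ConjClasses (ι → S) // C ≠ ConjClasses.mk 1} := fun σ =>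
    ⟨ConjClasses.mk (x ∘ σ), ne_one _ ⟨σ.symm i, by simpa using hi⟩⟩
  have hyj : P (y j) := by
    have := hP.iff_not_apply h j
    tauto
  let vy : ∀ σ : Equiv.Perm ι, {C : ConjClasses (ι → S) // C ≠ ConjClasses.mk 1} := fun σ =>
    ⟨ConjClasses.mk (y ∘ σ), ne_one _ ⟨σ.symm j, by simpa using hyj⟩⟩
  have hadj : ∀ σ, (invGenGraph (ι → S)).Adj (vx σ) (vy σ) := by
    refine fun σ => ⟨fun he => ?_, h.comp_perm σ⟩
    have hc := isConj_pi_iff.1 (ConjClasses.mk_eq_mk_iff_isConj.1 (congrArg Subtype.val he))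
      (σ.symm j)
    have := hP.iff_of_isConj hc
    simp only [Function.comp_apply, Equiv.apply_symm_apply] at this
    exact hj (this.2 hyj)
  let v : ∀ σ : Equiv.Perm ι, {C : {C : ConjClasses (ι → S) // C ≠ ConjClasses.mk 1} //
      ¬ (invGenGraph (ι → S)).IsIsolated C} := fun σ => ⟨vx σ, fun hiso => hiso _ (hadj σ)⟩
  refine Nat.card_le_card_of_injective
    (fun a => (invGenGraphPlus (ι → S)).connectedComponentMk (v (Equiv.swap a.1 b))) ?_
  rintro ⟨a, ha⟩ ⟨c, hc⟩ hac
  by_contra hne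
  have hne : a ≠ c := fun e => hne (Subtype.ext e)
  have hab : a ≠ b := by rintro rfl; exact ha Iff.rfl
  have key := hP.iff_of_reachable (SimpleGraph.ConnectedComponent.exact hac) a b
  change ((P ((ConjClasses.mk (x ∘ Equiv.swap a b)).out a) ↔
      P ((ConjClasses.mk (x ∘ Equiv.swap a b)).out b)) ↔
    (P ((ConjClasses.mk (x ∘ Equiv.swap c b)).out a) ↔
      P ((ConjClasses.mk (x ∘ Equiv.swap c b)).out b))) at key
  simp only [hP.iff_out, Function.comp_apply, Equiv.swap_apply_left, Equiv.swap_apply_right,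
    Equiv.swap_apply_of_ne_of_ne hne hab] at key
  grind

theorem lt_card_connectedComponent [Finite ι] [Finite S] {x y : ι → S}
    (h : InvariablyGenerates (ConjClasses.mk x) (ConjClasses.mk y)) {i j : ι}
    (hi : P (x i)) (hj : ¬ P (x j)) {n : ℕ} (hn : 2 * n + 2 ≤ Nat.card ι) :
    n < Nat.card (invGenGraphPlus (ι → S)).ConnectedComponent := by
  classical
  have := Fintype.ofFinite ι
  have h₁ := hP.card_le_card_connectedComponent h hi hj i
  have h₂ := hP.card_le_card_connectedComponent h hi hj j
  simp only [hi, hj, iff_true, iff_false, not_not] at h₁ h₂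
  have h₃ := Fintype.card_subtype_compl fun a => P (x a)
  have h₄ := Fintype.card_subtype_le fun a => P (x a)
  rw [Nat.card_eq_fintype_card] at h₁ h₂ hn
  omega

/-- Exchanging the two members of one pair keeps a power invariably generated, provided that `P`
holds at all coordinates of the first element. -/
theorem invariablyGenerates_swap [Finite ι] [DecidableEq ι] [Finite S] [IsSimpleGroup S]
    [Group.IsPerfect S] {x y : ι → S}
    (h : InvariablyGenerates (ConjClasses.mk x) (ConjClasses.mk y)) (hx : ∀ i, P (x i)) (i₀ : ι) :
    InvariablyGenerates (ConjClasses.mk (Function.update x i₀ (y i₀)))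
      (ConjClasses.mk (Function.update y i₀ (x i₀))) := by
  have hy : ∀ i, ¬ P (y i) := fun i => (hP.iff_not_apply h i).1 (hx i)
  rw [invariablyGenerates_pi_iff] at h ⊢
  refine ⟨fun i => ?_, fun i j hij => ?_⟩
  · by_cases hi : i = i₀
    · subst hi; simpa using (h.1 i).symm
    · simpa [hi] using h.1 i
  · rintro ⟨φ, h₁, h₂⟩
    have h₁' := (hP.map_iff φ _).symm.trans (hP.iff_of_isConj h₁)
    by_cases hi : i = i₀
    · subst hi
      simp [hij.symm, hx, hy] at h₁'
    · by_cases hj : j = i₀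
      · subst hj
        simp [hij, hx, hy] at h₁'
      · simp only [Function.update_of_ne hi, Function.update_of_ne hj] at h₁ h₂
        exact h.2 i j hij ⟨φ, h₁, h₂⟩

theorem lt_card_connectedComponent_of_isInvariablyTwoGenerated [Finite ι] [Finite S]
    [IsSimpleGroup S] [Group.IsPerfect S] (h : IsInvariablyTwoGenerated (ι → S)) {n : ℕ}
    (hn : 2 * n + 2 ≤ Nat.card ι) :
    n < Nat.card (invGenGraphPlus (ι → S)).ConnectedComponent := by
  classical
  obtain ⟨C, D, h⟩ := h
  obtain ⟨x, rfl⟩ := ConjClasses.mk_surjective C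
  obtain ⟨y, rfl⟩ := ConjClasses.mk_surjective D
  have : Nontrivial ι := Finite.one_lt_card_iff_nontrivial.1 (by omega)
  obtain ⟨i, j, hij⟩ := exists_pair_ne ι
  -- If `P` is constant along `x`, exchanging `x` and `y` at one coordinate makes it non-constant.
  by_cases h₁ : ∀ i, P (x i)
  · have hyi := (hP.iff_not_apply h i).1 (h₁ i)
    refine hP.lt_card_connectedComponent (i := j) (j := i) (hP.invariablyGenerates_swap h h₁ i)
      ?_ ?_ hn
    · simpa [hij.symm] using h₁ j
    · simpa using hyi
  by_cases h₂ : ∀ i, ¬ P (x i)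
  · have hy : ∀ i, P (y i) := fun i => by
      have := hP.iff_not_apply h i
      have := h₂ i
      tauto
    refine hP.lt_card_connectedComponent (i := j) (j := i)
      (hP.invariablyGenerates_swap h.symm hy i) ?_ ?_ hn
    · simpa [hij.symm] using hy j
    · simpa using h₂ i
  push Not at h₁ h₂
  obtain ⟨i, hi⟩ := h₁
  obtain ⟨j, hj⟩ := h₂
  exact hP.lt_card_connectedComponent h hj hi hn

end InvGenDichotomy

/-- A power with more factors than there are pairs of elements has two equal coordinate pairs, hence
is not invariably `2`-generated. -/
theorem IsInvariablyTwoGenerated.le_card_mul_card [Finite S] [IsSimpleGroup S] [Group.IsPerfect S]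
    {t : ℕ} (h : IsInvariablyTwoGenerated (Fin t → S)) : t ≤ Nat.card S * Nat.card S := by
  obtain ⟨C, D, h⟩ := h
  obtain ⟨x, rfl⟩ := ConjClasses.mk_surjective C
  obtain ⟨y, rfl⟩ := ConjClasses.mk_surjective D
  rw [invariablyGenerates_pi_iff] at h
  have hinj : Function.Injective fun i => (x i, y i) := by
    intro i j hij
    by_contra hne
    have h₁ : x i = x j := congrArg Prod.fst hij
    have h₂ : y i = y j := congrArg Prod.snd hij
    exact h.2 i j hne ⟨MulEquiv.refl S, h₁ ▸ IsConj.refl _, h₂ ▸ IsConj.refl _⟩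
  simpa [Nat.card_prod] using Nat.card_le_card_of_injective _ hinj

/-- Automorphisms preserve orders, so invariably generating pairs whose second members have
distinct orders are pairwise unlinked. -/
theorem isInvariablyTwoGenerated_of_orderOf_injective [Finite S] [IsSimpleGroup S]
    [Group.IsPerfect S] [Finite ι] {x y : ι → S}
    (h : ∀ i, InvariablyGenerates (ConjClasses.mk (x i)) (ConjClasses.mk (y i)))
    (hy : Function.Injective fun i => orderOf (y i)) : IsInvariablyTwoGenerated (ι → S) := by
  refine ⟨ConjClasses.mk x, ConjClasses.mk y, invariablyGenerates_pi_iff.2 ⟨h, ?_⟩⟩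
  rintro i j hij ⟨φ, -, h₂⟩
  refine hij (hy ?_)
  obtain ⟨c, hc⟩ := isConj_iff.1 h₂
  have h₃ := (MulAut.conj c).orderOf_eq (φ (y i))
  rw [MulAut.conj_apply, hc, φ.orderOf_eq] at h₃
  exact h₃.symm

theorem exists_isGreatest_isInvariablyTwoGenerated [Finite S] [IsSimpleGroup S]
    [Group.IsPerfect S] {N : ℕ} (h : IsInvariablyTwoGenerated (Fin N → S)) :
    ∃ β, IsGreatest {t : ℕ | IsInvariablyTwoGenerated (Fin t → S)} β ∧ N ≤ β := by
  have hbdd : BddAbove {t : ℕ | IsInvariablyTwoGenerated (Fin t → S)} :=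
    ⟨_, fun t ht => IsInvariablyTwoGenerated.le_card_mul_card ht⟩
  exact ⟨_, ⟨Nat.sSup_mem ⟨N, h⟩ hbdd, fun t ht => le_csSup hbdd ht⟩, le_csSup hbdd h⟩

end Components

/-! ### Finite fields inside an algebraic closure -/

section FrobeniusFixed

variable {F Ω : Type*} [Field F] [Fintype F] [Field Ω] [Algebra F Ω]

theorem FiniteField.exists_algebraMap_eq_of_pow_card_eq {z : Ω} (hz : z ^ Fintype.card F = z) :
    ∃ t : F, algebraMap F Ω t = z := by
  have h0 : (Polynomial.X ^ Fintype.card F - Polynomial.X : Polynomial F) ≠ 0 :=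
    FiniteField.X_pow_card_sub_X_ne_zero F Fintype.one_lt_card
  have hs : (Polynomial.X ^ Fintype.card F - Polynomial.X : Polynomial F).Splits := by
    rw [Polynomial.splits_iff_card_roots, FiniteField.roots_X_pow_card_sub_X,
      FiniteField.X_pow_card_sub_X_natDegree_eq F Fintype.one_lt_card]
    rfl
  exact hs.mem_range_of_isRoot h0 (x := z) (by simp [hz])

end FrobeniusFixed

/-! ### Conjugacy in `SL₂` over a finite field of characteristic two -/

section Conjugacy

variable {F : Type*} [Field F]

/-- The companion matrix of `X ^ 2 - s X + 1`. -/
def SL2.companion (s : F) : SL(2, F) :=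
  ⟨!![0, 1; -1, s], by simp [Matrix.det_fin_two]⟩

theorem SL2.isConj_of_mul_eq_mul [Finite F] [CharP F 2] {g h : SL(2, F)}
    {A : Matrix (Fin 2) (Fin 2) F} (hA : A.det ≠ 0) (hgh : g.1 * A = A * h.1) : IsConj h g := by
  -- In a perfect field of characteristic two `A` can be rescaled to have determinant one.
  obtain ⟨r, hr⟩ := surjective_frobenius F 2 A.det⁻¹
  rw [frobenius_def] at hr
  let B : SL(2, F) := ⟨r • A, by simp [hr, hA]⟩
  refine isConj_iff.2 ⟨B, ?_⟩
  rw [mul_inv_eq_iff_eq_mul]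
  refine Subtype.ext ?_
  change (r • A) * h.1 = g.1 * (r • A)
  rw [Matrix.smul_mul, Matrix.mul_smul, hgh]

theorem SL2.det_eq_one (g : SL(2, F)) : g.1 0 0 * g.1 1 1 - g.1 0 1 * g.1 1 0 = 1 := by
  rw [← Matrix.det_fin_two]; exact g.2

theorem SL2.isConj_companion [Finite F] [CharP F 2] {g : SL(2, F)} (hg : g ≠ 1) :
    IsConj (SL2.companion g.1.trace) g := by
  have hdet := SL2.det_eq_one g
  have key : ∀ A : Matrix (Fin 2) (Fin 2) F, A.det ≠ 0 →
      g.1 * A = A * !![0, 1; -1, g.1.trace] → IsConj (SL2.companion g.1.trace) g :=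
    fun A hA h => SL2.isConj_of_mul_eq_mul hA h
  generalize hα : g.1 0 0 = α at hdet
  generalize hβ : g.1 0 1 = β at hdet
  generalize hγ : g.1 1 0 = γ at hdet
  generalize hδ : g.1 1 1 = δ at hdet
  have hg' : g.1 = !![α, β; γ, δ] := by
    rw [← hα, ← hβ, ← hγ, ← hδ]; exact Matrix.eta_fin_two g.1
  rw [hg'] at key
  rw [hg']
  -- The columns of the conjugating matrix are `g w - (tr g) w` and `w`, for a vector `w` that is
  -- not an eigenvector: `w = e₁`, `w = e₂` or `w = e₁ + e₂`.
  by_cases hγ0 : γ = 0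
  · by_cases hβ0 : β = 0
    · have hne : α ≠ δ := by
        rintro rfl
        have h1 : α ^ 2 = 1 ^ 2 := by rw [one_pow, ← hdet, hβ0]; ring
        have h1 : α = 1 := frobenius_inj F 2 h1
        refine hg (Subtype.ext ?_)
        rw [hg', h1, hβ0, hγ0, Matrix.one_fin_two.symm]
        rfl
      refine key !![-δ, 1; -α, 1] ?_ ?_
      · simpa [Matrix.det_fin_two, sub_eq_zero, neg_add_eq_zero] using hne.symm
      · subst hγ0 hβ0
        ext i j
        fin_cases i <;> fin_cases j <;>
          simp [Matrix.mul_apply, Fin.sum_univ_two, Matrix.trace_fin_two] <;>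
          first | ring1 | linear_combination hdet
    · refine key !![β, 0; -α, 1] (by simpa [Matrix.det_fin_two] using hβ0) ?_
      ext i j
      fin_cases i <;> fin_cases j <;>
        simp [Matrix.mul_apply, Fin.sum_univ_two, Matrix.trace_fin_two] <;>
        first | ring1 | linear_combination hdet | linear_combination -hdet
  · refine key !![-δ, 1; γ, 0] (by simpa [Matrix.det_fin_two] using hγ0) ?_
    ext i j
    fin_cases i <;> fin_cases j <;>
      simp [Matrix.mul_apply, Fin.sum_univ_two, Matrix.trace_fin_two] <;>
      first | ring1 | linear_combination hdet | linear_combination -hdet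

theorem SL2.isConj_of_trace_eq [Finite F] [CharP F 2] {g h : SL(2, F)} (hg : g ≠ 1) (hh : h ≠ 1)
    (htr : g.1.trace = h.1.trace) : IsConj g h :=
  (SL2.isConj_companion hg).symm.trans (htr ▸ SL2.isConj_companion hh)

/-- The Borel subgroup of upper triangular matrices in `SL(2, F)`. -/
def SL2.borel (F : Type*) [Field F] : Subgroup SL(2, F) where
  carrier := {g | g.1 1 0 = 0}
  one_mem' := by simp
  mul_mem' {a b} ha hb := by
    simp only [Set.mem_ofPred_eq] at ha hb ⊢
    simp [Matrix.mul_apply, Fin.sum_univ_two, ha, hb]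
  inv_mem' {a} ha := by
    simp only [Set.mem_ofPred_eq] at ha ⊢
    simp [Matrix.SpecialLinearGroup.coe_inv, Matrix.adjugate_fin_two, ha]

theorem SL2.mem_borel {g : SL(2, F)} : g ∈ SL2.borel F ↔ g.1 1 0 = 0 := Iff.rfl

theorem SL2.borel_ne_top : SL2.borel F ≠ ⊤ := fun h => by
  have := SL2.mem_borel.1 (h ▸ Subgroup.mem_top (SL2.companion (0 : F)))
  simp [SL2.companion] at this

theorem SL2.exists_isConj_mem_borel [Finite F] [CharP F 2] {g : SL(2, F)} {l : F} (hl : l ≠ 0)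
    (htr : g.1.trace = l + l⁻¹) : ∃ b ∈ SL2.borel F, IsConj g b := by
  by_cases hg : g = 1
  · exact ⟨g, hg ▸ one_mem _, IsConj.refl _⟩
  · let b : SL(2, F) := ⟨!![l, 1; 0, l⁻¹], by simp [Matrix.det_fin_two, hl]⟩
    refine ⟨b, SL2.mem_borel.2 (by simp [b]), SL2.isConj_of_trace_eq hg (fun h => ?_) ?_⟩
    · have := congrArg (fun M : SL(2, F) => M.1 0 1) h
      simp [b] at this
    · simp [b, htr, Matrix.trace_fin_two]

theorem SL2.borel_pow_apply {b : SL(2, F)} (hb : b ∈ SL2.borel F) (n : ℕ) :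
    (b ^ n).1 0 0 = b.1 0 0 ^ n := by
  induction n with
  | zero => simp
  | succ n ih =>
    have h := SL2.mem_borel.1 hb
    rw [pow_succ, pow_succ, ← ih]
    change ((b ^ n).1 * b.1) 0 0 = _
    rw [Matrix.mul_apply, Fin.sum_univ_two, h]
    ring

/-- A nontrivial upper triangular matrix over a field of even order `q` has order not dividing
`q + 1`: its diagonal is trivial, so it is an involution. -/
theorem SL2.eq_one_of_mem_borel [Fintype F] [CharP F 2] {b : SL(2, F)} (hb : b ∈ SL2.borel F)
    (h : b ^ (Fintype.card F + 1) = 1) : b = 1 := by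
  have h10 := SL2.mem_borel.1 hb
  have hdet := SL2.det_eq_one b
  rw [h10, mul_zero, sub_zero] at hdet
  have hl : b.1 0 0 ^ (Fintype.card F + 1) = 1 := by
    rw [← SL2.borel_pow_apply hb, h]; simp
  rw [pow_succ, FiniteField.pow_card, ← pow_two] at hl
  have h00 : b.1 0 0 = 1 := frobenius_inj F 2 (by simpa [frobenius_def] using hl)
  have h11 : b.1 1 1 = 1 := by rwa [h00, one_mul] at hdet
  have hb2 : b ^ 2 = 1 := by
    refine Subtype.ext ?_
    rw [pow_two]
    change b.1 * b.1 = 1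
    ext i j
    fin_cases i <;> fin_cases j <;>
      simp [Matrix.mul_apply, Fin.sum_univ_two, h00, h11, h10, CharTwo.add_self_eq_zero]
  obtain ⟨m, hm⟩ := Nat.even_iff.2 (FiniteField.even_card_of_char_two (ringChar.eq F 2))
  rw [hm, ← two_mul, pow_succ, pow_mul, hb2, one_pow, one_mul] at h
  exact h

end Conjugacy

/-! ### Coordinates adapted to a non-split torus -/

section TorusCoordinates

variable {F Ω : Type*} [Field F] [Field Ω] [Algebra F Ω]

/-- For `g ∈ SL(2, F)` and `u ≠ w` in an extension `Ω`, write `g (1, u) = a (1, u) + c (1, w)`.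
This is the coefficient `a`. -/
def SL2.coeffA (u w : Ω) (g : SL(2, F)) : Ω :=
  (algebraMap F Ω (g.1 1 0) + algebraMap F Ω (g.1 1 1) * u
    - w * (algebraMap F Ω (g.1 0 0) + algebraMap F Ω (g.1 0 1) * u)) / (u - w)

/-- For `g ∈ SL(2, F)` and `u ≠ w` in an extension `Ω`, write `g (1, u) = a (1, u) + c (1, w)`.
This is the coefficient `c`. -/
def SL2.coeffC (u w : Ω) (g : SL(2, F)) : Ω :=
  (u * (algebraMap F Ω (g.1 0 0) + algebraMap F Ω (g.1 0 1) * u)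
    - (algebraMap F Ω (g.1 1 0) + algebraMap F Ω (g.1 1 1) * u)) / (u - w)

namespace SL2

variable {u w : Ω}

theorem coeffA_one (h : u ≠ w) : coeffA u w (1 : SL(2, F)) = 1 := by
  have h' := sub_ne_zero.2 h
  simp [coeffA, h']

theorem coeffC_one : coeffC u w (1 : SL(2, F)) = 0 := by
  simp [coeffC]

theorem coeffA_mul (h : u ≠ w) (g k : SL(2, F)) :
    coeffA u w (g * k) = coeffA u w g * coeffA u w k + coeffC w u g * coeffC u w k := by
  have h₁ := sub_ne_zero.2 h
  have h₂ := sub_ne_zero.2 h.symm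
  have h₃ : w - u = -(u - w) := by ring
  simp only [coeffA, coeffC, Matrix.SpecialLinearGroup.coe_mul, Matrix.mul_apply, Fin.sum_univ_two,
    map_add, map_mul, h₃]
  field_simp
  ring

theorem coeffC_mul (h : u ≠ w) (g k : SL(2, F)) :
    coeffC u w (g * k) = coeffC u w g * coeffA u w k + coeffA w u g * coeffC u w k := by
  have h₁ := sub_ne_zero.2 h
  have h₂ := sub_ne_zero.2 h.symm
  have h₃ : w - u = -(u - w) := by ring
  simp only [coeffA, coeffC, Matrix.SpecialLinearGroup.coe_mul, Matrix.mul_apply, Fin.sum_univ_two,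
    map_add, map_mul, h₃]
  field_simp
  ring

theorem coeffA_mul_sub_coeffC_mul (h : u ≠ w) (g : SL(2, F)) :
    coeffA u w g * coeffA w u g - coeffC u w g * coeffC w u g = 1 := by
  have h₁ := sub_ne_zero.2 h
  have h₃ : w - u = -(u - w) := by ring
  have hdet := congrArg (algebraMap F Ω) (SL2.det_eq_one g)
  simp only [map_sub, map_mul, map_one] at hdet
  simp only [coeffA, coeffC, h₃]
  field_simp
  linear_combination (u - w) ^ 2 * hdet

theorem coeffA_add_coeffA (h : u ≠ w) (g : SL(2, F)) :
    coeffA u w g + coeffA w u g = algebraMap F Ω g.1.trace := by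
  have h₁ := sub_ne_zero.2 h
  have h₃ : w - u = -(u - w) := by ring
  simp only [coeffA, h₃, Matrix.trace_fin_two, map_add]
  field_simp
  ring

theorem eq_of_coeff_eq (h : u ≠ w) {g k : SL(2, F)} (h₁ : coeffA u w g = coeffA u w k)
    (h₂ : coeffC u w g = coeffC u w k) (h₃ : coeffA w u g = coeffA w u k)
    (h₄ : coeffC w u g = coeffC w u k) : g = k := by
  have h₀ := sub_ne_zero.2 h
  have h₀' := sub_ne_zero.2 h.symm
  simp only [coeffA, coeffC, div_left_inj' h₀, div_left_inj' h₀'] at h₁ h₂ h₃ h₄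
  have inj := (algebraMap F Ω).injective
  have e01 : g.1 0 1 = k.1 0 1 := inj (mul_left_cancel₀ (pow_ne_zero 2 h₀)
    (by linear_combination h₁ + h₂ + h₃ + h₄))
  have e00 : g.1 0 0 = k.1 0 0 := inj (mul_left_cancel₀ h₀ (by
    rw [e01] at h₁ h₂; linear_combination h₁ + h₂))
  have e11 : g.1 1 1 = k.1 1 1 := inj (mul_left_cancel₀ h₀ (by
    rw [e01, e00] at h₁ h₃; linear_combination h₁ - h₃))
  have e10 : g.1 1 0 = k.1 1 0 := inj (by
    rw [e01, e00, e11] at h₁; linear_combination h₁)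
  refine Subtype.ext (Matrix.ext fun i j => ?_)
  fin_cases i <;> fin_cases j <;> assumption

theorem map_coeffA (f : Ω →ₐ[F] Ω) (u w : Ω) (g : SL(2, F)) :
    f (coeffA u w g) = coeffA (f u) (f w) g := by
  simp [coeffA]

theorem map_coeffC (f : Ω →ₐ[F] Ω) (u w : Ω) (g : SL(2, F)) :
    f (coeffC u w g) = coeffC (f u) (f w) g := by
  simp [coeffC]

/-- The norm of the coefficient `c` of `g`; it vanishes exactly on the torus with eigenvectors
`(1, u)` and `(1, w)`, and determines the double coset of `g` with respect to that torus. -/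
def normC (u w : Ω) (g : SL(2, F)) : Ω := coeffC u w g * coeffC w u g

theorem coeffA_companion (h : u ≠ w) (huw : u * w = 1) {s : F} (hs : algebraMap F Ω s = u + w) :
    coeffA u w (companion s) = u := by
  have h₁ := sub_ne_zero.2 h
  simp only [coeffA, companion, Matrix.of_apply, Matrix.cons_val', Matrix.cons_val_zero,
    Matrix.cons_val_one, Matrix.cons_val_fin_one, map_neg, map_one, map_zero, hs]
  field_simp
  linear_combination huw

theorem coeffC_companion (huw : u * w = 1) {s : F} (hs : algebraMap F Ω s = u + w) :
    coeffC u w (companion s) = 0 := by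
  simp only [coeffC, companion, Matrix.of_apply, Matrix.cons_val', Matrix.cons_val_zero,
    Matrix.cons_val_one, Matrix.cons_val_fin_one, map_neg, map_one, map_zero, hs]
  rw [div_eq_zero_iff]
  left
  linear_combination - huw

theorem coeffA_coeffC_companion_pow (h : u ≠ w) (huw : u * w = 1) {s : F}
    (hs : algebraMap F Ω s = u + w) (n : ℕ) :
    coeffA u w (companion s ^ n) = u ^ n ∧ coeffC u w (companion s ^ n) = 0 := by
  induction n with
  | zero => simp [coeffA_one h, coeffC_one]
  | succ n ih =>
    rw [pow_succ, coeffA_mul h, coeffC_mul h, ih.1, ih.2, coeffA_companion h huw hs,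
      coeffC_companion huw hs]
    exact ⟨by ring, by ring⟩

end SL2

end TorusCoordinates

/-! ### Overgroups of a non-split torus in even characteristic -/

section NonsplitTorus

variable (F : Type*) {Ω : Type*} [Field F] [Fintype F] [Field Ω] [Algebra F Ω]

/-- `IsTorusGenerator F u s` says that `u ∈ Ω` generates the group of elements of norm one of the
quadratic extension of `F`, and that `u` has trace `s`. The companion matrix of `X ^ 2 - s X + 1`
then generates a non-split torus of `SL(2, F)`. -/
structure IsTorusGenerator (u : Ω) (s : F) : Prop where
  isPrimitiveRoot : IsPrimitiveRoot u (Fintype.card F + 1)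
  trace_eq : algebraMap F Ω s = u + u⁻¹

variable {F}

theorem FiniteField.even_card [CharP F 2] : Even (Fintype.card F) :=
  Nat.even_iff.2 (FiniteField.even_card_of_char_two (ringChar.eq F 2))

theorem FiniteField.coprime_two_card_add_one [CharP F 2] : Nat.Coprime 2 (Fintype.card F + 1) :=
  Nat.coprime_two_left.2 FiniteField.even_card.add_one

theorem exists_isTorusGenerator [CharP F 2] [IsAlgClosed Ω] :
    ∃ (u : Ω) (s : F), IsTorusGenerator F u s := by
  have : CharP Ω 2 := charP_of_injective_algebraMap (algebraMap F Ω).injective 2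
  have hcast : ((Fintype.card F + 1 : ℕ) : Ω) ≠ 0 := by
    obtain ⟨m, hm⟩ := FiniteField.even_card (F := F)
    rw [hm]
    simp [CharTwo.add_self_eq_zero]
  have : NeZero ((Fintype.card F + 1 : ℕ) : Ω) := ⟨hcast⟩
  obtain ⟨u, hu⟩ := HasEnoughRootsOfUnity.exists_primitiveRoot Ω (Fintype.card F + 1)
  have huq : u ^ Fintype.card F = u⁻¹ :=
    eq_inv_of_mul_eq_one_left (by rw [← pow_succ]; exact hu.pow_eq_one)
  obtain ⟨s, hs⟩ := FiniteField.exists_algebraMap_eq_of_pow_card_eq (F := F) (z := u + u⁻¹) (by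
    change FiniteField.frobeniusAlgHom F Ω (u + u⁻¹) = _
    rw [map_add, map_inv₀]
    change u ^ Fintype.card F + (u ^ Fintype.card F)⁻¹ = _
    rw [huq, inv_inv, add_comm])
  exact ⟨u, s, hu, hs⟩

namespace IsTorusGenerator

variable {u : Ω} {s : F} (hu : IsTorusGenerator F u s)
include hu

theorem pow_card : u ^ Fintype.card F = u⁻¹ :=
  eq_inv_of_mul_eq_one_left (by rw [← pow_succ]; exact hu.isPrimitiveRoot.pow_eq_one)

theorem ne_zero : u ≠ 0 := hu.isPrimitiveRoot.ne_zero (by simp)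

theorem ne_inv : u ≠ u⁻¹ := fun h => by
  have h2 : u ^ 2 = 1 := by rw [pow_two]; nth_rw 1 [h]; exact inv_mul_cancel₀ hu.ne_zero
  have := Nat.le_of_dvd two_pos (hu.isPrimitiveRoot.dvd_of_pow_eq_one _ h2)
  have := Fintype.one_lt_card (α := F)
  omega

theorem frobenius_apply : FiniteField.frobeniusAlgHom F Ω u = u⁻¹ := hu.pow_card

theorem frobenius_apply_inv : FiniteField.frobeniusAlgHom F Ω u⁻¹ = u := by
  rw [map_inv₀, hu.frobenius_apply, inv_inv]

theorem frobenius_coeffA (g : SL(2, F)) :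
    SL2.coeffA u u⁻¹ g ^ Fintype.card F = SL2.coeffA u⁻¹ u g := by
  rw [← FiniteField.frobeniusAlgHom_apply F Ω, SL2.map_coeffA]
  simp only [hu.frobenius_apply, hu.frobenius_apply_inv]

theorem frobenius_coeffC (g : SL(2, F)) :
    SL2.coeffC u u⁻¹ g ^ Fintype.card F = SL2.coeffC u⁻¹ u g := by
  rw [← FiniteField.frobeniusAlgHom_apply F Ω, SL2.map_coeffC]
  simp only [hu.frobenius_apply, hu.frobenius_apply_inv]

theorem frobenius_coeffA' (g : SL(2, F)) :
    SL2.coeffA u⁻¹ u g ^ Fintype.card F = SL2.coeffA u u⁻¹ g := by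
  rw [← FiniteField.frobeniusAlgHom_apply F Ω, SL2.map_coeffA]
  simp only [hu.frobenius_apply, hu.frobenius_apply_inv]

theorem frobenius_coeffC' (g : SL(2, F)) :
    SL2.coeffC u⁻¹ u g ^ Fintype.card F = SL2.coeffC u u⁻¹ g := by
  rw [← FiniteField.frobeniusAlgHom_apply F Ω, SL2.map_coeffC]
  simp only [hu.frobenius_apply, hu.frobenius_apply_inv]

theorem eq_of_coeff_eq {g k : SL(2, F)} (hA : SL2.coeffA u u⁻¹ g = SL2.coeffA u u⁻¹ k)
    (hC : SL2.coeffC u u⁻¹ g = SL2.coeffC u u⁻¹ k) : g = k :=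
  SL2.eq_of_coeff_eq hu.ne_inv hA hC
    (by rw [← hu.frobenius_coeffA, hA, hu.frobenius_coeffA])
    (by rw [← hu.frobenius_coeffC, hC, hu.frobenius_coeffC])

theorem coeff_companion_pow (n : ℕ) :
    SL2.coeffA u u⁻¹ (SL2.companion s ^ n) = u ^ n ∧
      SL2.coeffC u u⁻¹ (SL2.companion s ^ n) = 0 ∧
      SL2.coeffA u⁻¹ u (SL2.companion s ^ n) = u⁻¹ ^ n ∧
      SL2.coeffC u⁻¹ u (SL2.companion s ^ n) = 0 := by
  have h₁ := SL2.coeffA_coeffC_companion_pow hu.ne_inv (mul_inv_cancel₀ hu.ne_zero) hu.trace_eq n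
  have h₂ := SL2.coeffA_coeffC_companion_pow hu.ne_inv.symm (inv_mul_cancel₀ hu.ne_zero)
    (hu.trace_eq.trans (add_comm _ _)) n
  exact ⟨h₁.1, h₁.2, h₂.1, h₂.2⟩

theorem companion_pow_eq_one : SL2.companion s ^ (Fintype.card F + 1) = 1 := by
  obtain ⟨hA, hC, -⟩ := hu.coeff_companion_pow (Fintype.card F + 1)
  refine hu.eq_of_coeff_eq ?_ ?_
  · rw [hA, hu.isPrimitiveRoot.pow_eq_one, SL2.coeffA_one hu.ne_inv]
  · rw [hC, SL2.coeffC_one]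

/-- Powers `u ^ e` with `e` prime to `q + 1` still generate all elements of norm one. -/
theorem exists_pow_pow_eq {e : ℕ} (he : e.Coprime (Fintype.card F + 1)) {z : Ω}
    (hz : z ^ (Fintype.card F + 1) = 1) :
    ∃ k : ℕ, (u ^ e) ^ k = z :=
  ((hu.isPrimitiveRoot.pow_of_coprime e he).eq_pow_of_pow_eq_one hz).imp fun _ h => h.2

/-- Elements of equal norm differ by a power of `u`. -/
theorem exists_eq_pow_mul {x y : Ω} (h : x * x ^ Fintype.card F = y * y ^ Fintype.card F) :
    ∃ k : ℕ, x = u ^ k * y := by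
  rw [← pow_succ', ← pow_succ'] at h
  by_cases hy : y = 0
  · subst hy
    exact ⟨0, by simpa using h⟩
  · obtain ⟨k, hk⟩ := hu.exists_pow_pow_eq (Nat.coprime_one_left _) (z := x / y)
      (by rw [div_pow, h, div_self (pow_ne_zero _ hy)])
    exact ⟨k, by rw [← pow_one u, hk, div_mul_cancel₀ _ hy]⟩

theorem coeffA_mul_eq (g : SL(2, F)) :
    SL2.coeffA u u⁻¹ g * SL2.coeffA u⁻¹ u g = 1 + SL2.normC u u⁻¹ g := by
  rw [SL2.normC, ← SL2.coeffA_mul_sub_coeffC_mul hu.ne_inv g]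
  ring

theorem exists_algebraMap_eq_normC (g : SL(2, F)) : ∃ t : F, algebraMap F Ω t = SL2.normC u u⁻¹ g :=
  FiniteField.exists_algebraMap_eq_of_pow_card_eq (by
    rw [SL2.normC, mul_pow, hu.frobenius_coeffC, hu.frobenius_coeffC', mul_comm])

/-- The norm of `c` on `g x ^ k h`, where `x` generates the torus: it is additive up to the trace of
an element whose argument rotates with `k`. -/
theorem normC_mul_pow_mul [CharP Ω 2] (g h : SL(2, F)) (k : ℕ) :
    SL2.normC u u⁻¹ (g * (SL2.companion s ^ k * h)) = SL2.normC u u⁻¹ g + SL2.normC u u⁻¹ h +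
      (SL2.coeffC u u⁻¹ g * SL2.coeffA u u⁻¹ g * (SL2.coeffA u u⁻¹ h * SL2.coeffC u⁻¹ u h) *
          u ^ (2 * k) +
        SL2.coeffC u⁻¹ u g * SL2.coeffA u⁻¹ u g * (SL2.coeffA u⁻¹ u h * SL2.coeffC u u⁻¹ h) *
          u⁻¹ ^ (2 * k)) := by
  obtain ⟨h₁, h₂, h₃, h₄⟩ := hu.coeff_companion_pow k
  have hg := hu.coeffA_mul_eq g
  have hh := hu.coeffA_mul_eq h
  have huk : u ^ k * u⁻¹ ^ k = 1 := by rw [← mul_pow, mul_inv_cancel₀ hu.ne_zero, one_pow]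
  have h2 : (2 : Ω) = 0 := CharTwo.two_eq_zero
  simp only [SL2.normC] at hg hh ⊢
  simp only [SL2.coeffC_mul hu.ne_inv, SL2.coeffC_mul hu.ne_inv.symm, SL2.coeffA_mul hu.ne_inv,
    SL2.coeffA_mul hu.ne_inv.symm, h₁, h₂, h₃, h₄]
  generalize SL2.coeffC u u⁻¹ g = c at *
  generalize SL2.coeffC u⁻¹ u g = c' at *
  generalize SL2.coeffA u u⁻¹ g = a at *
  generalize SL2.coeffA u⁻¹ u g = a' at *
  generalize SL2.coeffC u u⁻¹ h = e at *
  generalize SL2.coeffC u⁻¹ u h = e' at *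
  generalize SL2.coeffA u u⁻¹ h = b at *
  generalize SL2.coeffA u⁻¹ u h = b' at *
  have hU : u ^ (2 * k) = u ^ k * u ^ k := by rw [two_mul, pow_add]
  have hW : u⁻¹ ^ (2 * k) = u⁻¹ ^ k * u⁻¹ ^ k := by rw [two_mul, pow_add]
  rw [hU, hW]
  generalize u ^ k = U at *
  generalize u⁻¹ ^ k = W at *
  linear_combination (c * c' * b * b' + e * e' * a * a') * huk + c * c' * hh + e * e' * hg +
    c * c' * e * e' * h2

/-- For a subgroup `H` containing the torus, the norms of `c` over `H` form an additive subgroup of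
`F`: in a product `g x ^ k h` the power of the torus generator can be chosen so that the trace term
vanishes. -/
def normSubgroup [CharP F 2] [CharP Ω 2] (H : Subgroup SL(2, F)) (hH : SL2.companion s ∈ H) :
    AddSubgroup F where
  carrier := {t | ∃ h ∈ H, algebraMap F Ω t = SL2.normC u u⁻¹ h}
  zero_mem' := ⟨1, H.one_mem, by simp [SL2.normC, SL2.coeffC_one]⟩
  neg_mem' := by
    rintro t ⟨h, hh, ht⟩
    exact ⟨h, hh, by rw [CharTwo.neg_eq, ht]⟩
  add_mem' := by
    rintro t₁ t₂ ⟨g, hg, ht₁⟩ ⟨h, hh, ht₂⟩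
    set z := SL2.coeffC u u⁻¹ g * SL2.coeffA u u⁻¹ g *
      (SL2.coeffA u u⁻¹ h * SL2.coeffC u⁻¹ u h) with hz
    set z' := SL2.coeffC u⁻¹ u g * SL2.coeffA u⁻¹ u g *
      (SL2.coeffA u⁻¹ u h * SL2.coeffC u u⁻¹ h) with hz'
    have hzz' : z ^ Fintype.card F = z' := by
      simp only [hz, hz', mul_pow, hu.frobenius_coeffA, hu.frobenius_coeffC, hu.frobenius_coeffC']
    have hz'z : z' ^ Fintype.card F = z := by
      simp only [hz, hz', mul_pow, hu.frobenius_coeffA', hu.frobenius_coeffC, hu.frobenius_coeffC']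
    obtain ⟨k, hk⟩ : ∃ k : ℕ, z * u ^ (2 * k) + z' * u⁻¹ ^ (2 * k) = 0 := by
      by_cases hz0 : z = 0
      · have : z' = 0 := by rw [← hzz', hz0, zero_pow Fintype.card_ne_zero]
        exact ⟨0, by simp [hz0, this]⟩
      · obtain ⟨k, hk⟩ := hu.exists_pow_pow_eq (e := 4) (z := z' / z)
          (FiniteField.coprime_two_card_add_one.pow_left 2) (by
          have hz0' : z' ≠ 0 := fun h => hz0 (by rw [← hz'z, h, zero_pow Fintype.card_ne_zero])
          rw [pow_succ, div_pow, hzz', hz'z]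
          field_simp)
        refine ⟨k, ?_⟩
        rw [eq_div_iff hz0, ← pow_mul] at hk
        have h4 : u ^ (4 * k) * u⁻¹ ^ (2 * k) = u ^ (2 * k) := by
          rw [show 4 * k = 2 * k + 2 * k by ring, pow_add, mul_assoc, ← mul_pow,
            mul_inv_cancel₀ hu.ne_zero, one_pow, mul_one]
        rw [← hk]
        linear_combination z * h4 + CharTwo.add_self_eq_zero (z * u ^ (2 * k))
    refine ⟨g * (SL2.companion s ^ k * h), H.mul_mem hg (H.mul_mem (H.pow_mem hH k) hh), ?_⟩
    rw [hu.normC_mul_pow_mul, hk, map_add, ht₁, ht₂, add_zero]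

omit hu in
theorem mem_normSubgroup [CharP F 2] [CharP Ω 2] {hu : IsTorusGenerator F u s}
    {H : Subgroup SL(2, F)} {hH : SL2.companion s ∈ H} {t : F} :
    t ∈ hu.normSubgroup H hH ↔ ∃ h ∈ H, algebraMap F Ω t = SL2.normC u u⁻¹ h := Iff.rfl

/-- If the norms over `H` exhaust `F`, then `H` meets every double coset of the torus. -/
theorem eq_top_of_normSubgroup_eq_top [CharP F 2] [CharP Ω 2] {H : Subgroup SL(2, F)}
    (hH : SL2.companion s ∈ H) (htop : hu.normSubgroup H hH = ⊤) : H = ⊤ := by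
  refine (Subgroup.eq_top_iff' H).2 fun g => ?_
  obtain ⟨t, ht⟩ := hu.exists_algebraMap_eq_normC g
  obtain ⟨h, hh, hth⟩ := mem_normSubgroup.1 (htop ▸ AddSubgroup.mem_top t)
  rw [ht] at hth
  obtain ⟨m, hm⟩ := hu.exists_eq_pow_mul (x := SL2.coeffA u u⁻¹ g) (y := SL2.coeffA u u⁻¹ h) (by
    rw [hu.frobenius_coeffA, hu.frobenius_coeffA, hu.coeffA_mul_eq, hu.coeffA_mul_eq, hth])
  obtain ⟨p, hp⟩ := hu.exists_eq_pow_mul (x := SL2.coeffC u u⁻¹ g) (y := SL2.coeffC u u⁻¹ h) (by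
    rw [hu.frobenius_coeffC, hu.frobenius_coeffC]; exact hth)
  have hcop := FiniteField.coprime_two_card_add_one (F := F)
  have hroot : ∀ k, (u ^ k) ^ (Fintype.card F + 1) = 1 := fun k => by
    rw [← pow_mul, mul_comm, pow_mul, hu.isPrimitiveRoot.pow_eq_one, one_pow]
  -- The left and right rotations are `u ^ k` and `u ^ l` with `u ^ (k + l) = u ^ m` and
  -- `u ^ (l - k) = u ^ p`; they exist since squaring is bijective on the torus.
  obtain ⟨l, hl⟩ := hu.exists_pow_pow_eq hcop (hroot (m + p))
  obtain ⟨k, hk⟩ := hu.exists_pow_pow_eq hcop (z := u ^ m * (u ^ p)⁻¹) (by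
    rw [mul_pow, inv_pow, hroot, hroot, inv_one, mul_one])
  have hu0 := hu.ne_zero
  have hup : u ^ p ≠ 0 := pow_ne_zero _ hu0
  have hukl : u ^ k * u ^ l = u ^ m := frobenius_inj Ω 2 (by
    simp only [frobenius_def]
    rw [mul_pow, ← pow_mul, ← pow_mul, mul_comm k, mul_comm l, pow_mul, pow_mul, hk, hl, pow_add]
    field_simp)
  have hulk : u⁻¹ ^ k * u ^ l = u ^ p := frobenius_inj Ω 2 (by
    simp only [frobenius_def]
    rw [mul_pow, inv_pow, inv_pow, ← pow_mul, ← pow_mul, mul_comm k, mul_comm l, pow_mul, pow_mul,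
      hk, hl, pow_add]
    field_simp)
  obtain ⟨k₁, k₂, k₃, k₄⟩ := hu.coeff_companion_pow k
  obtain ⟨l₁, l₂, l₃, l₄⟩ := hu.coeff_companion_pow l
  have : g = SL2.companion s ^ k * h * SL2.companion s ^ l := by
    refine hu.eq_of_coeff_eq ?_ ?_
    · rw [SL2.coeffA_mul hu.ne_inv, SL2.coeffA_mul hu.ne_inv, k₁, k₄, l₁, l₂, hm, ← hukl]
      ring
    · rw [SL2.coeffC_mul hu.ne_inv, SL2.coeffC_mul hu.ne_inv, k₂, k₃, l₁, l₂, hp, ← hulk]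
      ring
  rw [this]
  exact H.mul_mem (H.mul_mem (H.pow_mem hH k) hh) (H.pow_mem hH l)

/-- An element `h` of `H` outside the normalizer of the torus contributes the norms of
`h x ^ k h`, which are multiples of traces of `q + 1` distinct elements of equal norm; as at most
two of these share a trace, more than half of `F` is reached. -/
theorem normSubgroup_eq_top [CharP F 2] [CharP Ω 2] {H : Subgroup SL(2, F)}
    (hH : SL2.companion s ∈ H) {h : SL(2, F)} (hh : h ∈ H)
    (hA : SL2.coeffA u u⁻¹ h ≠ 0) (hC : SL2.coeffC u u⁻¹ h ≠ 0) : hu.normSubgroup H hH = ⊤ := by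
  classical
  set a := SL2.coeffA u u⁻¹ h with ha
  set a' := SL2.coeffA u⁻¹ u h with ha'
  set c := SL2.coeffC u u⁻¹ h with hc
  set c' := SL2.coeffC u⁻¹ u h with hc'
  have hc'0 : c' ≠ 0 := by rw [hc', ← hu.frobenius_coeffC]; exact pow_ne_zero _ hC
  have hu0 := hu.ne_zero
  have hnorm : ∀ k, SL2.normC u u⁻¹ (h * (SL2.companion s ^ k * h)) =
      c * c' * (a ^ 2 * u ^ (2 * k) + a' ^ 2 * u⁻¹ ^ (2 * k)) := fun k => by
    rw [hu.normC_mul_pow_mul, CharTwo.add_self_eq_zero]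
    ring
  have hmem : ∀ k, h * (SL2.companion s ^ k * h) ∈ H := fun k =>
    H.mul_mem hh (H.mul_mem (H.pow_mem hH k) hh)
  choose t ht using fun k => hu.exists_algebraMap_eq_normC (h * (SL2.companion s ^ k * h))
  have hcop := FiniteField.coprime_two_card_add_one (F := F)
  have hinj : Set.InjOn (fun k => a ^ 2 * u ^ (2 * k))
      (Finset.range (Fintype.card F + 1) : Finset ℕ) := by
    intro k hk l hl hkl
    have := mul_left_cancel₀ (pow_ne_zero 2 hA) hkl
    rw [pow_mul, pow_mul] at this
    exact (hu.isPrimitiveRoot.pow_of_coprime 2 hcop).pow_inj (by simpa using hk) (by simpa using hl)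
      this
  have hfib : ∀ x ∈ (Finset.range (Fintype.card F + 1)).image t,
      ((Finset.range (Fintype.card F + 1)).filter fun k => t k = x).card ≤ 2 := by
    intro x hx
    obtain ⟨l, -, rfl⟩ := Finset.mem_image.1 hx
    refine (Finset.card_le_card_of_injOn (t := {a ^ 2 * u ^ (2 * l), a' ^ 2 * u⁻¹ ^ (2 * l)})
      (fun k => a ^ 2 * u ^ (2 * k)) ?_
      (hinj.mono (Finset.coe_subset.2 (Finset.filter_subset _ _)))).trans Finset.card_le_two
    intro k hk
    have hkl : t k = t l := (Finset.mem_filter.1 hk).2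
    have hsum : a ^ 2 * u ^ (2 * k) + a' ^ 2 * u⁻¹ ^ (2 * k) =
        a ^ 2 * u ^ (2 * l) + a' ^ 2 * u⁻¹ ^ (2 * l) :=
      mul_left_cancel₀ (mul_ne_zero hC hc'0) (by rw [← hnorm, ← hnorm, ← ht, ← ht, hkl])
    have hprod : ∀ k, a ^ 2 * u ^ (2 * k) * (a' ^ 2 * u⁻¹ ^ (2 * k)) = a ^ 2 * a' ^ 2 := fun k => by
      have : u ^ (2 * k) * u⁻¹ ^ (2 * k) = 1 := by
        rw [← mul_pow, mul_inv_cancel₀ hu0, one_pow]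
      linear_combination a ^ 2 * a' ^ 2 * this
    have hfac : (a ^ 2 * u ^ (2 * k) - a ^ 2 * u ^ (2 * l)) *
        (a ^ 2 * u ^ (2 * k) - a' ^ 2 * u⁻¹ ^ (2 * l)) = 0 := by
      linear_combination a ^ 2 * u ^ (2 * k) * hsum - hprod k + hprod l
    simp only [Finset.coe_insert, Finset.coe_singleton, Set.mem_insert_iff, Set.mem_singleton_iff]
    rcases mul_eq_zero.1 hfac with h | h
    · exact Or.inl (sub_eq_zero.1 h)
    · exact Or.inr (sub_eq_zero.1 h)
  have hcard := Finset.card_le_mul_card_image (f := t) _ 2 hfib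
  have hle : ((Finset.range (Fintype.card F + 1)).image t).card ≤
      Nat.card (hu.normSubgroup H hH) := by
    rw [← Set.ncard_coe_finset]
    refine Set.ncard_le_ncard (t := (hu.normSubgroup H hH : Set F)) ?_ (Set.toFinite _)
    intro x hx
    obtain ⟨k, -, rfl⟩ := Finset.mem_image.1 (Finset.mem_coe.1 hx)
    exact ⟨_, hmem k, ht k⟩
  rw [Finset.card_range] at hcard
  -- A subgroup with more than half of the elements is the whole group.
  refine AddSubgroup.eq_top_of_card_eq _ ?_
  obtain ⟨m, hm⟩ := (hu.normSubgroup H hH).card_addSubgroup_dvd_card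
  rw [Nat.card_eq_fintype_card (α := F)] at hm ⊢
  have hpos := Fintype.card_pos (α := F)
  have hm1 : m < 2 := by
    by_contra! h2
    have := Nat.mul_le_mul_left (Nat.card (hu.normSubgroup H hH)) h2
    omega
  have hm0 : m ≠ 0 := by rintro rfl; omega
  obtain rfl : m = 1 := by omega
  omega

/-- A subgroup containing the torus generator and an element that is neither of order two nor of
order dividing `q + 1` is everything. -/
theorem eq_top_of_mem [CharP F 2] [CharP Ω 2] {H : Subgroup SL(2, F)}
    (hH : SL2.companion s ∈ H) {h : SL(2, F)} (hh : h ∈ H) (h2 : h ^ 2 ≠ 1)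
    (hq : h ^ (Fintype.card F + 1) ≠ 1) : H = ⊤ := by
  refine hu.eq_top_of_normSubgroup_eq_top hH (hu.normSubgroup_eq_top hH hh ?_ ?_)
  · -- If `a = 0`, then `h` inverts the torus, and is an involution.
    intro hA
    have hA' : SL2.coeffA u⁻¹ u h = 0 := by
      rw [← hu.frobenius_coeffA, hA, zero_pow Fintype.card_ne_zero]
    have hdet := SL2.coeffA_mul_sub_coeffC_mul hu.ne_inv h
    rw [hA, zero_mul, zero_sub, CharTwo.neg_eq] at hdet
    refine h2 (hu.eq_of_coeff_eq ?_ ?_)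
    · rw [pow_two, SL2.coeffA_mul hu.ne_inv, hA, zero_mul, zero_add, mul_comm, hdet,
        SL2.coeffA_one hu.ne_inv]
    · rw [pow_two, SL2.coeffC_mul hu.ne_inv, hA, hA', SL2.coeffC_one, mul_zero, zero_mul, zero_add]
  · -- If `c = 0`, then `h` is a power of the torus generator.
    intro hC
    have hn := hu.coeffA_mul_eq h
    rw [SL2.normC, hC, zero_mul, add_zero, ← hu.frobenius_coeffA, ← pow_succ'] at hn
    obtain ⟨k, hk⟩ := hu.exists_pow_pow_eq (Nat.coprime_one_left _) hn
    obtain ⟨k₁, k₂, -⟩ := hu.coeff_companion_pow k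
    have : h = SL2.companion s ^ k :=
      hu.eq_of_coeff_eq (by rw [k₁, ← hk, pow_one]) (by rw [k₂, hC])
    refine hq ?_
    rw [this, ← pow_mul, mul_comm, pow_mul, hu.companion_pow_eq_one, one_pow]

/-- Every element of `SL(2, F)` is conjugate to an upper triangular matrix or to an element of the
non-split torus, according to where the roots of its characteristic polynomial lie. -/
theorem exists_isConj [CharP F 2] [IsAlgClosed Ω] (g : SL(2, F)) :
    (∃ b ∈ SL2.borel F, IsConj g b) ∨ ∃ k : ℕ, IsConj g (SL2.companion s ^ k) := by
  set e := algebraMap F Ω g.1.trace with he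
  obtain ⟨l, hl⟩ := IsAlgClosed.exists_root
    (Polynomial.X ^ 2 - Polynomial.C e * Polynomial.X + 1 : Polynomial Ω) (by
      have : (Polynomial.X ^ 2 - Polynomial.C e * Polynomial.X + 1 : Polynomial Ω).degree = 2 := by
        compute_degree!
      rw [this]; decide)
  simp only [Polynomial.IsRoot.def, Polynomial.eval_add, Polynomial.eval_sub, Polynomial.eval_pow,
    Polynomial.eval_X, Polynomial.eval_mul, Polynomial.eval_C, Polynomial.eval_one] at hl
  have hl0 : l ≠ 0 := by rintro rfl; simp at hl
  have hel : e = l + l⁻¹ := by field_simp; linear_combination -hl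
  have hl' : (l ^ Fintype.card F) ^ 2 - e * l ^ Fintype.card F + 1 = 0 := by
    have := congrArg (FiniteField.frobeniusAlgHom F Ω) hl
    simpa only [map_add, map_sub, map_mul, map_pow, map_one, map_zero, he, AlgHom.commutes,
      FiniteField.frobeniusAlgHom_apply] using this
  have hfac : (l ^ Fintype.card F - l) * (l ^ Fintype.card F * l - 1) = 0 := by
    rw [hel] at hl'
    field_simp at hl'
    linear_combination hl'
  rcases mul_eq_zero.1 hfac with h | h
  · left
    obtain ⟨m, hm⟩ := FiniteField.exists_algebraMap_eq_of_pow_card_eq (sub_eq_zero.1 h)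
    refine SL2.exists_isConj_mem_borel (l := m) (fun h0 => hl0 (by rw [← hm, h0, map_zero])) ?_
    refine (algebraMap F Ω).injective ?_
    rw [← he, hel, map_add, map_inv₀, hm]
  · by_cases hg : g = 1
    · exact Or.inl ⟨g, hg ▸ one_mem _, IsConj.refl _⟩
    obtain ⟨k, hk⟩ := hu.exists_pow_pow_eq (Nat.coprime_one_left _) (z := l)
      (by rw [pow_succ]; exact sub_eq_zero.1 h)
    rw [pow_one] at hk
    obtain ⟨k₁, -, k₃, -⟩ := hu.coeff_companion_pow k
    by_cases hx : SL2.companion s ^ k = 1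
    · left
      have hl1 : l = 1 := by rw [← hk, ← k₁, hx, SL2.coeffA_one hu.ne_inv]
      refine SL2.exists_isConj_mem_borel (l := 1) one_ne_zero ((algebraMap F Ω).injective ?_)
      rw [← he, hel, hl1]; simp
    · refine Or.inr ⟨k, SL2.isConj_of_trace_eq hg hx ((algebraMap F Ω).injective ?_)⟩
      rw [← he, hel, ← SL2.coeffA_add_coeffA hu.ne_inv, k₁, k₃, inv_pow, hk]

end IsTorusGenerator

end NonsplitTorus

/-! ### Invariable generation of `PSL₂` in even characteristic -/

section SpecialLinear

variable {F : Type*} [Field F] [Fintype F] [CharP F 2]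

theorem SL2.pow_card_add_one_ne_one_of_isConj_mem_borel {g b : SL(2, F)} (hb : b ∈ SL2.borel F)
    (hgb : IsConj g b) (hg : g ≠ 1) : g ^ (Fintype.card F + 1) ≠ 1 := by
  intro h
  obtain ⟨c, rfl⟩ := isConj_iff.1 hgb
  have := SL2.eq_one_of_mem_borel hb (by rw [conj_pow, h]; simp)
  exact hg (by simpa using this)

/-- In an invariably generating pair of `SL(2, F)` exactly one member is a nontrivial element of a
non-split torus: two others are conjugate into a common Borel subgroup, and two such elements are
conjugate into a common torus. -/
theorem SL2.invGenDichotomy :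
    InvGenDichotomy fun g : SL(2, F) => g ^ (Fintype.card F + 1) = 1 ∧ g ≠ 1 where
  map_iff φ a := by simp [← map_pow]
  not_one := by simp
  iff_not a b hab := by
    obtain ⟨u, s, hu⟩ := exists_isTorusGenerator (F := F) (Ω := AlgebraicClosure F)
    have : CharP (AlgebraicClosure F) 2 :=
      charP_of_injective_algebraMap (algebraMap F (AlgebraicClosure F)).injective 2
    rw [invariablyGenerates_mk_iff] at hab
    have hB : ∀ g : SL(2, F), ¬ (g ^ (Fintype.card F + 1) = 1 ∧ g ≠ 1) →
        ∃ b ∈ SL2.borel F, IsConj g b := by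
      intro g hg
      rcases hu.exists_isConj g with h | ⟨k, hk⟩
      · exact h
      · obtain ⟨c, hc⟩ := isConj_iff.1 hk.symm
        have hg1 : g ^ (Fintype.card F + 1) = 1 := by
          rw [← hc, conj_pow, ← pow_mul, mul_comm k, pow_mul, hu.companion_pow_eq_one]
          simp
        have hg2 : g = 1 := by
          by_contra h
          exact hg ⟨hg1, h⟩
        exact ⟨g, hg2 ▸ one_mem _, IsConj.refl _⟩
    have hT : ∀ g : SL(2, F), g ^ (Fintype.card F + 1) = 1 ∧ g ≠ 1 →
        ∃ k : ℕ, IsConj g (SL2.companion s ^ k) := by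
      intro g hg
      rcases hu.exists_isConj g with ⟨b, hb, hgb⟩ | h
      · exact absurd hg.1 (SL2.pow_card_add_one_ne_one_of_isConj_mem_borel hb hgb hg.2)
      · exact h
    constructor
    · intro ha hb
      obtain ⟨k, hk⟩ := hT a ha
      obtain ⟨l, hl⟩ := hT b hb
      have hle : Subgroup.closure {SL2.companion s ^ k, SL2.companion s ^ l} ≤
          Subgroup.zpowers (SL2.companion s) := by
        rw [Subgroup.closure_le]
        rintro _ (rfl | rfl) <;> exact Subgroup.npow_mem_zpowers _ _
      rw [hab _ _ hk hl, top_le_iff] at hle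
      -- A transvection is not in the torus, because its order is two.
      let g : SL(2, F) := ⟨!![1, 1; 0, 1], by simp [Matrix.det_fin_two]⟩
      have hg : g ≠ 1 := fun h => by
        have := congrArg (fun M : SL(2, F) => M.1 0 1) h
        simp [g] at this
      refine SL2.pow_card_add_one_ne_one_of_isConj_mem_borel (g := g)
        (SL2.mem_borel.2 (by simp [g])) (IsConj.refl g) hg ?_
      obtain ⟨m, hm⟩ := Subgroup.mem_zpowers_iff.1 (hle ▸ Subgroup.mem_top g)
      rw [← hm, ← zpow_natCast, ← zpow_mul, mul_comm, zpow_mul, zpow_natCast,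
        hu.companion_pow_eq_one, one_zpow]
    · intro hb
      by_contra ha
      obtain ⟨x, hx, hax⟩ := hB a ha
      obtain ⟨y, hy, hby⟩ := hB b hb
      refine SL2.borel_ne_top (F := F) (top_le_iff.1 ?_)
      rw [← hab _ _ hax hby, Subgroup.closure_le]
      rintro _ (rfl | rfl) <;> assumption

/-- A generator of a non-split torus together with any element of a class of order not dividing
`2` or `q + 1` invariably generates `SL(2, F)`. -/
theorem SL2.exists_invariablyGenerates :
    ∃ x : SL(2, F), ∀ y : SL(2, F), y ^ 2 ≠ 1 → y ^ (Fintype.card F + 1) ≠ 1 →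
      InvariablyGenerates (ConjClasses.mk x) (ConjClasses.mk y) := by
  obtain ⟨u, s, hu⟩ := exists_isTorusGenerator (F := F) (Ω := AlgebraicClosure F)
  have : CharP (AlgebraicClosure F) 2 :=
    charP_of_injective_algebraMap (algebraMap F (AlgebraicClosure F)).injective 2
  refine ⟨SL2.companion s, fun y h2 hq => invariablyGenerates_mk_iff.2 fun x' y' hx hy => ?_⟩
  obtain ⟨c, rfl⟩ := isConj_iff.1 hx
  obtain ⟨d, rfl⟩ := isConj_iff.1 hy
  -- Conjugating back by `c`, it suffices to generate with the torus generator itself.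
  have hconj : ∀ n, (c⁻¹ * (d * y * d⁻¹) * c) ^ n = 1 → y ^ n = 1 := by
    intro n h
    have h' : c⁻¹ * (d * y * d⁻¹) * c = (c⁻¹ * d) * y * (c⁻¹ * d)⁻¹ := by group
    rwa [h', conj_pow, conj_eq_one_iff] at h
  have key : (Subgroup.closure {c * SL2.companion s * c⁻¹, d * y * d⁻¹}).map
      (MulAut.conj c⁻¹).toMonoidHom = ⊤ := by
    refine hu.eq_top_of_mem ⟨_, Subgroup.subset_closure (Set.mem_insert _ _), ?_⟩
      (h := c⁻¹ * (d * y * d⁻¹) * c)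
      ⟨_, Subgroup.subset_closure (Set.mem_insert_of_mem _ rfl), ?_⟩
      (fun h => h2 (hconj 2 h)) (fun h => hq (hconj _ h))
    · change c⁻¹ * (c * SL2.companion s * c⁻¹) * c⁻¹⁻¹ = _
      group
    · change c⁻¹ * (d * y * d⁻¹) * c⁻¹⁻¹ = _
      rw [inv_inv]
  exact Subgroup.map_injective (MulAut.conj c⁻¹).injective
    (key.trans (Subgroup.map_top_of_surjective _ (MulAut.conj c⁻¹).surjective).symm)

omit [CharP F 2] in
theorem SL2.exists_orderOf_eq {d : ℕ} (hd : d ∣ Fintype.card F - 1) :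
    ∃ y : SL(2, F), orderOf y = d := by
  let f : Fˣ →* SL(2, F) :=
    { toFun := fun z => ⟨!![(z : F), 0; 0, (z⁻¹ : Fˣ)], by simp [Matrix.det_fin_two]⟩
      map_one' := by
        refine Subtype.ext ?_
        simp [Matrix.one_fin_two]
      map_mul' := fun z w => by
        refine Subtype.ext ?_
        change (!![_, 0; 0, _] : Matrix (Fin 2) (Fin 2) F) = !![_, 0; 0, _] * !![_, 0; 0, _]
        simp [mul_comm] }
  have hf : Function.Injective f := fun z w h => Units.ext (by
    exact congrArg (fun M : SL(2, F) => M.1 0 0) h)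
  obtain ⟨z, hz⟩ := IsCyclic.exists_generator (α := Fˣ)
  have hz' : orderOf z = Fintype.card F - 1 := by
    rw [orderOf_eq_card_of_forall_mem_zpowers hz, Nat.card_units, Nat.card_eq_fintype_card]
  have hpos : Fintype.card F - 1 ≠ 0 := by
    have := Fintype.one_lt_card (α := F)
    omega
  refine ⟨f (z ^ (orderOf z / d)), ?_⟩
  rw [orderOf_injective f hf, orderOf_pow_orderOf_div (hz' ▸ hpos) (hz' ▸ hd)]

omit [Fintype F] in
/-- The centre of `SL(2, F)` is trivial in characteristic two. -/
theorem SL2.center_eq_bot : Subgroup.center SL(2, F) = ⊥ := by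
  rw [eq_bot_iff]
  intro A hA
  obtain ⟨r, hr, hrA⟩ := Matrix.SpecialLinearGroup.mem_center_iff.1 hA
  have hr1 : r = 1 := frobenius_inj F 2 (by simpa [frobenius_def] using hr)
  rw [Subgroup.mem_bot]
  refine Subtype.ext ?_
  rw [← hrA, hr1, map_one]
  rfl

omit [Fintype F] in
theorem PSL2.nonempty_mulEquiv : Nonempty (SL(2, F) ≃* PSL(2, F)) :=
  ⟨MulEquiv.ofBijective (QuotientGroup.mk' _) ⟨(MonoidHom.ker_eq_bot_iff _).1
    ((QuotientGroup.ker_mk' _).trans SL2.center_eq_bot), QuotientGroup.mk'_surjective _⟩⟩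

end SpecialLinear

theorem InvGenDichotomy.of_mulEquiv {S T : Type*} [Group S] [Group T] (e : S ≃* T) {P : S → Prop}
    (hP : InvGenDichotomy P) : InvGenDichotomy fun t => P (e.symm t) where
  map_iff φ a := by
    have := hP.map_iff ((e.trans φ).trans e.symm) (e.symm a)
    simpa using this
  not_one := by simpa using hP.not_one
  iff_not a b h := hP.iff_not _ _ (h.map_mulEquiv e.symm)

/-- Over the field with `2 ^ 2 ^ N` elements the divisors `2 ^ 2 ^ (i + 1) - 1` of `q - 1` provide
`N` invariably generating pairs with a common first member and second members of distinct orders. -/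
theorem PSL2.isInvariablyTwoGenerated_pow {F : Type*} [Field F] [Fintype F] [CharP F 2] {N : ℕ}
    (hF : Fintype.card F = 2 ^ 2 ^ N) [IsSimpleGroup PSL(2, F)] [Group.IsPerfect PSL(2, F)] :
    IsInvariablyTwoGenerated (Fin N → PSL(2, F)) := by
  obtain ⟨e⟩ := PSL2.nonempty_mulEquiv (F := F)
  obtain ⟨x, hx⟩ := SL2.exists_invariablyGenerates (F := F)
  have hdvd : ∀ i : Fin N, 2 ^ 2 ^ (i.1 + 1) - 1 ∣ Fintype.card F - 1 := fun i => by
    rw [hF]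
    exact Nat.pow_sub_one_dvd_pow_sub_one 2 (pow_dvd_pow 2 i.2)
  have hge : ∀ i : Fin N, 4 ≤ 2 ^ 2 ^ (i.1 + 1) := fun i => by
    calc 4 = 2 ^ 2 ^ 1 := rfl
      _ ≤ 2 ^ 2 ^ (i.1 + 1) := Nat.pow_le_pow_right two_pos (Nat.pow_le_pow_right two_pos (by omega))
  choose y hy using fun i => SL2.exists_orderOf_eq (hdvd i)
  refine isInvariablyTwoGenerated_of_orderOf_injective (x := fun _ => e x) (y := fun i => e (y i))
    (fun i => (hx (y i) ?_ ?_).map_mulEquiv e) ?_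
  · intro h
    have := Nat.le_of_dvd two_pos (orderOf_dvd_of_pow_eq_one h)
    have := hge i
    rw [hy] at *
    omega
  · intro h
    have h₁ := orderOf_dvd_of_pow_eq_one h
    rw [hy] at h₁
    have hcard := Fintype.one_lt_card (α := F)
    have h₂ := (Nat.dvd_sub h₁ (hdvd i))
    have h₃ : Fintype.card F + 1 - (Fintype.card F - 1) = 2 := by omega
    rw [h₃] at h₂
    have := Nat.le_of_dvd two_pos h₂
    have := hge i
    omega
  · intro i j hij
    simp only [MulEquiv.orderOf_eq, hy] at hij
    have hi := hge i
    have hj := hge j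
    have h₁ : 2 ^ 2 ^ (i.1 + 1) = 2 ^ 2 ^ (j.1 + 1) := by omega
    have h₂ := Nat.pow_right_injective le_rfl (Nat.pow_right_injective le_rfl h₁)
    exact Fin.ext (by simpa using h₂)

/-! ### Many connected components -/

theorem theorem1p1 (n : ℕ) (hn : 0 < n) :
    ∃ (G : Type) (_ : Group G), Finite G ∧
      n < Nat.card (invGenGraphPlus G).ConnectedComponent ∧
      ∃ (F : Type) (_ : Field F) (β : ℕ), Finite F ∧ 4 ≤ Nat.card F ∧
        IsGreatest {t : ℕ | IsInvariablyTwoGenerated (Fin t → PSL(2, F))} β ∧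
        Nonempty (G ≃* (Fin β → PSL(2, F))) := by
  classical
  -- At least `β / 2` components are found, so `β ≥ 2 * n + 2` is needed.
  let F := GaloisField 2 (2 ^ (2 * n + 2))
  have : Fintype F := Fintype.ofFinite F
  have hF : Nat.card F = 2 ^ 2 ^ (2 * n + 2) := GaloisField.card 2 _ (by positivity)
  have hF4 : 4 ≤ Nat.card F := by
    rw [hF]
    calc 4 = 2 ^ 2 ^ 1 := rfl
      _ ≤ 2 ^ 2 ^ (2 * n + 2) :=
        Nat.pow_le_pow_right two_pos (Nat.pow_le_pow_right two_pos (by omega))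
  have hsimple : IsSimpleGroup PSL(2, F) :=
    Matrix.ProjectiveSpecialLinearGroup.rank_two_simple hF4
  obtain ⟨e⟩ := PSL2.nonempty_mulEquiv (F := F)
  have hP := (SL2.invGenDichotomy (F := F)).of_mulEquiv e
  have : Group.IsPerfect PSL(2, F) := ⟨SL2Simple.PSL_commutator_eq_top (by
    obtain ⟨a, ha⟩ : ∃ a, a ∉ ({0, 1} : Finset F) := by
      by_contra! h
      have h₁ := Finset.card_le_card fun a (_ : a ∈ Finset.univ) => h a
      have h₂ : ({0, 1} : Finset F).card ≤ 2 := Finset.card_le_two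
      rw [Finset.card_univ, ← Nat.card_eq_fintype_card] at h₁
      omega
    simp only [Finset.mem_insert, Finset.mem_singleton, not_or] at ha
    exact ⟨a, ha.1, fun h => ha.2 (frobenius_inj F 2 (by simpa [frobenius_def] using h))⟩)⟩
  have : Finite PSL(2, F) := Finite.of_equiv _ e.toEquiv
  obtain ⟨β, hβ, hle⟩ := exists_isGreatest_isInvariablyTwoGenerated
    (PSL2.isInvariablyTwoGenerated_pow (F := F) (N := 2 * n + 2)
      (by rw [← Nat.card_eq_fintype_card, hF]))
  exact ⟨Fin β → PSL(2, F), inferInstance, inferInstance,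
    hP.lt_card_connectedComponent_of_isInvariablyTwoGenerated hβ.1 (by simpa using hle),
    F, inferInstance, β, inferInstance, hF4, hβ, ⟨MulEquiv.refl _⟩⟩
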